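/- **Setting.** Let $n,m\ge 0$ be integers; all spaces carry the Euclidean inner product and norm, $\mathbb R^n\times\mathbb R^n$ that of $\mathbb R^{2n}$. A sequence $(y_k)$ *converges to $\bar y$ from direction $v$* if $y_k=\bar y+t_kv_k$ for some $t_k>0$, $t_k\to0$, $v_k\to v$. For a set $\Omega$ and $z\in\Omega$, the tangent cone $T_\Omega(z)$ consists of all $u$ such that some sequence in $\Omega$ converges to $z$ from direction $u$; $\widehat N_\Omega(z)=\{z^*\mid \langle z^*,u\rangle\le 0\ \forall u\in T_\Omega(z)\}$ is the regular normal cone; and $N_\Omega(z)$, the limiting normal cone, consists of all limits of sequences $z_k^*\in\widehat N_\Omega(z_k)$ with $z_k\in\Omega$, $z_k\to z$. All three are empty if $z\notin\Omega$. A set $\Omega$ is *Clarke regular near* $\bar z$ if $\widehat N_\Omega(z)=N_\Omega(z)$ for all $z$ in a neighbourhood of $\bar z$. A set is *convex polyhedral* if it is an intersection of finitely many closed half-spaces. The distance to the empty set is $+\infty$, and $\mathrm{sp}$ denotes the linear hull ($\mathrm{sp}\,\emptyset=\{0\}$). For a set-valued map $S$, a point $\bar y$, a direction $v$ and $\Omega\subset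 \mathrm{dom}\,S=\{y\mid S(y)\ne\emptyset\}$: * $S$ is *inner semicompact at $\bar y$ wrt $\Omega$* if for every sequence $y_k\to\bar y$ in $\Omega$ there are an infinite set $K\subset\mathbb N$ and $\lambda_k\in S(y_k)$, $k\in K$, such that $(\lambda_k)_{k\in K}$ converges. * $S$ is *inner calm\* at $\bar y$ in direction $v$ wrt $\Omega$* if there is $\kappa>0$ such that for every sequence $(y_k)$ in $\Omega$ converging to $\bar y$ from direction $v$ there are an infinite set $K\subset\mathbb N$, a point $\bar\lambda$, and $\lambda_k\in S(y_k)$ with $\|\lambda_k-\bar\lambda\|\le\kappa\|y_k-\bar y\|$ for all $k\in K$. * $S$ is *inner calm\* at $\bar y$ wrt $\Omega$ in the fuzzy sense* if for every unit vector $v\in T_\Omega(\bar y)$ there are $\kappa>0$, a sequence $(y_k)$ in $\Omega$ converging to $\bar y$ from direction $v$, a point $\bar\lambda$, and $\lambda_k\in S(y_k)$ with $\|\lambda_k-\bar\lambda\|\le\kappa\|y_k-\bar y\|$ for all $k$. **Theorem.** Let $Q\subset\mathbb R^m$ be closed, let $\varphi:\mathbb R^n\to\mathbb R^m$ be twice continuously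 differentiable with Jacobian $\nabla\varphi$, put $C=\varphi^{-1}(Q)$, and let $x^*\in N_C(x)$. Assume that the constraint mapping $M(\cdot)=\varphi(\cdot)-Q$ is metrically subregular at $(x,0)$, i.e. there are $\kappa>0$ and a neighbourhood $U$ of $x$ with $$\mathrm{dist}(x',C)\le\kappa\,\mathrm{dist}(0,M(x'))=\kappa\,\mathrm{dist}(\varphi(x'),Q)\qquad\forall x'\in U.$$ Consider the multiplier map $\Lambda:\mathbb R^n\times\mathbb R^n\rightrightarrows\mathbb R^m$, $$\Lambda(y,y^*)=\{\lambda\in N_Q(\varphi(y))\mid\nabla\varphi(y)^T\lambda=y^*\}.$$ 1. If $Q$ is Clarke regular near $\varphi(x)$ (which is the case if $Q$ is convex), then $\Lambda$ is inner semicompact at $(x,x^*)$ wrt $\mathrm{dom}\,\Lambda$. 2. If $Q$ is convex polyhedral, then $\Lambda$ is inner calm\* at $(x,x^*)$ wrt $\mathrm{dom}\,\Lambda$ in the fuzzy sense. 3. Let $(u,u^*)\in\mathbb R^n\times\mathbb R^n$ be a unit vector. If $Q$ is convex polyhedral and the system $\varphi(\cdot)\in Q$ is non-degenerate at $x$ in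 direction $u$, i.e. $$\nabla\varphi(x)^T\lambda=0,\quad \lambda\in\mathrm{sp}\,N_{T_Q(\varphi(x))}(\nabla\varphi(x)u)\ \Longrightarrow\ \lambda=0,$$ then $\Lambda$ is inner calm\* at $(x,x^*)$ in direction $(u,u^*)$ wrt $\mathrm{dom}\,\Lambda$. -/

import Mathlib

open Filter Topology

noncomputable section

/-! ### Sequences from a direction, tangent and normal cones -/

section Cones

variable {E : Type*} [NormedAddCommGroup E] [InnerProductSpace ℝ E]

/-- The sequence `y` converges to `ybar` *from direction* `v`: there are `t k ↓ 0` and `w k → v`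
with `y k = ybar + t k • w k`. -/
def ConvergesFromDirection (y : ℕ → E) (ybar v : E) : Prop :=
  ∃ (t : ℕ → ℝ) (w : ℕ → E), (∀ k, 0 < t k) ∧ Tendsto t atTop (𝓝 0) ∧
    Tendsto w atTop (𝓝 v) ∧ ∀ k, y k = ybar + t k • w k

/-- The tangent (Bouligand, contingent) cone `T_Ω(x)`; it is empty if `x ∉ Ω`. -/
def bouligandCone (Ω : Set E) (x : E) : Set E :=
  {u | x ∈ Ω ∧ ∃ y : ℕ → E, (∀ k, y k ∈ Ω) ∧ ConvergesFromDirection y x u}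

/-- The regular (Fréchet) normal cone, the polar of the tangent cone; it is empty if `x ∉ Ω`. -/
def regularNormalCone (Ω : Set E) (x : E) : Set E :=
  {z | x ∈ Ω ∧ ∀ u ∈ bouligandCone Ω x, inner ℝ z u ≤ 0}

/-- The limiting (Mordukhovich) normal cone `N_Ω(x)`; it is empty if `x ∉ Ω`. -/
def limitingNormalCone (Ω : Set E) (x : E) : Set E :=
  {z | x ∈ Ω ∧ ∃ (y w : ℕ → E), Tendsto y atTop (𝓝 x) ∧ Tendsto w atTop (𝓝 z) ∧
    ∀ k, w k ∈ regularNormalCone Ω (y k)}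

/-- `Ω` is Clarke regular at every point (of `Ω`) near `x`. At points outside `Ω` both cones are
empty, so nothing is required there. -/
def ClarkeRegularNear (Ω : Set E) (x : E) : Prop :=
  ∀ᶠ z in 𝓝 x, regularNormalCone Ω z = limitingNormalCone Ω z

/-- A convex polyhedral set: an intersection of finitely many closed half-spaces. -/
def IsConvexPolyhedral (D : Set E) : Prop :=
  ∃ (N : ℕ) (a : Fin N → E) (b : Fin N → ℝ), D = {z | ∀ i, inner ℝ (a i) z ≤ b i}

end Cones

/-! ### Continuity and Lipschitzian notions for set-valued maps

A set-valued map from `E` to `F` is a function `E → Set F`. -/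

section SetValued

variable {E F : Type*} [NormedAddCommGroup E] [InnerProductSpace ℝ E]
  [NormedAddCommGroup F] [InnerProductSpace ℝ F]

/-- The domain of a set-valued map. -/
def svDom (S : E → Set F) : Set E := {y | (S y).Nonempty}

/-- The graph of a set-valued map. -/
def svGraph (S : E → Set F) : Set (E × F) := {p | p.2 ∈ S p.1}

/-- Metric subregularity of `M` at `(x, y) ∈ gph M`: near `x`, one has
`dist (x', M⁻¹ y) ≤ κ * dist (y, M x')`, where the distance to the empty set is `∞`. -/
def MetricallySubregularAt (M : E → Set F) (x : E) (y : F) : Prop :=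
  (x, y) ∈ svGraph M ∧ ∃ κ : ℝ, 0 < κ ∧ ∀ᶠ x' in 𝓝 x,
    Metric.infEDist x' {z | y ∈ M z} ≤ ENNReal.ofReal κ * Metric.infEDist y (M x')

/-- `S` is inner semicompact at `ybar` with respect to `Ω`. -/
def InnerSemicompactAt (S : E → Set F) (ybar : E) (Ω : Set E) : Prop :=
  ∀ y : ℕ → E, (∀ k, y k ∈ Ω) → Tendsto y atTop (𝓝 ybar) →
    ∃ (σ : ℕ → ℕ) (x : ℕ → F) (xbar : F), StrictMono σ ∧
      (∀ j, x j ∈ S (y (σ j))) ∧ Tendsto x atTop (𝓝 xbar)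

/-- `S` is inner calm* at `ybar` in direction `v` with respect to `Ω`. The constant `κ` is the same
for all sequences, while the limit `xbar` may depend on the sequence. -/
def InnerCalmStarInDirection (S : E → Set F) (ybar v : E) (Ω : Set E) : Prop :=
  ∃ κ : ℝ, 0 < κ ∧ ∀ y : ℕ → E, (∀ k, y k ∈ Ω) → ConvergesFromDirection y ybar v →
    ∃ (σ : ℕ → ℕ) (x : ℕ → F) (xbar : F), StrictMono σ ∧
      ∀ j, x j ∈ S (y (σ j)) ∧ ‖x j - xbar‖ ≤ κ * ‖y (σ j) - ybar‖

/-- `S` is inner calm* at `ybar` in direction `v` with respect to `Ω` in the fuzzy sense. -/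
def FuzzyInnerCalmStarInDirection (S : E → Set F) (ybar v : E) (Ω : Set E) : Prop :=
  v ∉ bouligandCone Ω ybar ∨
    ∃ κ : ℝ, 0 < κ ∧ ∃ (y : ℕ → E) (x : ℕ → F) (xbar : F),
      (∀ k, y k ∈ Ω) ∧ ConvergesFromDirection y ybar v ∧
      ∀ k, x k ∈ S (y k) ∧ ‖x k - xbar‖ ≤ κ * ‖y k - ybar‖

/-- `S` is inner calm* at `ybar` with respect to `Ω` in the fuzzy sense: it is so in every
direction of the unit sphere. -/
def FuzzyInnerCalmStarAt (S : E → Set F) (ybar : E) (Ω : Set E) : Prop :=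
  ∀ v ∈ Metric.sphere (0 : E) 1, FuzzyInnerCalmStarInDirection S ybar v Ω

end SetValued

/-! ### Constraint systems and multipliers

The space `ℝⁿ × ℝⁿ` of pairs `(x, x*)` carries the Euclidean norm (`WithLp 2`). -/

section Multipliers

variable {n m : ℕ}

/-- The constraint mapping `M(x) = φ(x) - Q`. -/
def constraintMap (φ : EuclideanSpace ℝ (Fin n) → EuclideanSpace ℝ (Fin m))
    (Q : Set (EuclideanSpace ℝ (Fin m))) :
    EuclideanSpace ℝ (Fin n) → Set (EuclideanSpace ℝ (Fin m)) :=
  fun x => {y | ∃ q ∈ Q, y = φ x - q}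

/-- The multiplier map `Λ(x, x*) = {lam ∈ N_Q(φ(x)) | ∇φ(x)ᵀ lam = x*}`. -/
def multiplierMap (φ : EuclideanSpace ℝ (Fin n) → EuclideanSpace ℝ (Fin m))
    (Q : Set (EuclideanSpace ℝ (Fin m))) :
    WithLp 2 (EuclideanSpace ℝ (Fin n) × EuclideanSpace ℝ (Fin n)) →
      Set (EuclideanSpace ℝ (Fin m)) :=
  fun p => {lam | lam ∈ limitingNormalCone Q (φ p.fst) ∧
    ContinuousLinearMap.adjoint (fderiv ℝ φ p.fst) lam = p.snd}

/-- The system `φ(·) ∈ Q` is non-degenerate at `x` in direction `u`. -/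
def NondegenerateInDirection (φ : EuclideanSpace ℝ (Fin n) → EuclideanSpace ℝ (Fin m))
    (Q : Set (EuclideanSpace ℝ (Fin m))) (x u : EuclideanSpace ℝ (Fin n)) : Prop :=
  ∀ lam : EuclideanSpace ℝ (Fin m),
    ContinuousLinearMap.adjoint (fderiv ℝ φ x) lam = 0 →
    lam ∈ Submodule.span ℝ (limitingNormalCone (bouligandCone Q (φ x)) (fderiv ℝ φ x u)) →
    lam = 0

end Multipliers

end

/-!
The proof rests on a quantitative multiplier rule. If `φ(·) ∈ Q` is metrically subregular with
modulus `κ`, every regular normal `z` to `φ ⁻¹' Q` at a point close to `x` has a multiplier of norm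
at most `κ * ‖z‖` (`exists_multiplier_norm_le`). Indeed, exact penalization makes the point a local
minimizer of `-⟪z, ·⟫ + ε ‖· - xbar‖ + L ‖φ(·) - q‖` over all `x` and all `q ∈ Q`
(`eventually_inner_le_add_penalty`). Replacing the norms by `√(‖·‖² + δ²)` keeps minimizers close by
and makes Fermat's rule available in `x` and in `q` separately; the penalty gradient is then an
approximate multiplier (`exists_approx_multiplier`), and a compactness argument concludes.

Under Clarke regularity of `Q`, pairs in `dom Λ` have second components that are regular normals to
`φ ⁻¹' Q`, so they have locally bounded multipliers, and a convergent subsequence exists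
(`exists_convergent_multipliers`). This is inner semicompactness.

For polyhedral `Q`, let `lam k → l` be such multipliers along a sequence from direction `(u, u*)`.
After passing to a subsequence they lie in one normal cone `K`, generated by finitely many vectors
(Farkas' lemma). Dividing the multiplier equation by `t k` shows that `∇φ(x)ᵀ` sends `(lam k - l) /
t k ∈ K - ℝ₊ l` to a sequence converging to `u* - ∇²⟨l, φ⟩(x) u`. Linear images of finitely
generated cones are closed (`isClosed_generatedCone`), so some `ω ∈ K - ℝ₊ l` is mapped to that
limit (`exists_conic_solution`); the multipliers `l + t k • ω` provide a new sequence from the same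
direction, with linear rate. This is fuzzy inner calmness*.

If moreover the system is non-degenerate in direction `u`, then `lam k` and `l` lie in the span of
`N_{T_Q(φ x)}(∇φ(x) u)` (`eventually_limitingNormalCone_subset`). As `∇φ(x)ᵀ` is bounded below
there, `‖lam k - l‖` is bounded by the residual `‖∇φ(x)ᵀ lam k - x*‖`, which is of the order of the
distance of the pair to `(x, x*)`, uniformly in the sequence.
-/

/-! ### Tangent and normal cones, convex sets -/

section ConvexSets

variable {E : Type*} [NormedAddCommGroup E] [InnerProductSpace ℝ E]

theorem ConvergesFromDirection.tendsto {y : ℕ → E} {ybar v : E}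
    (h : ConvergesFromDirection y ybar v) : Tendsto y atTop (𝓝 ybar) := by
  obtain ⟨t, w, -, ht0, hw, hy⟩ := h
  have : Tendsto (fun k => ybar + t k • w k) atTop (𝓝 (ybar + (0 : ℝ) • v)) :=
    tendsto_const_nhds.add (ht0.smul hw)
  simpa [funext hy] using this

theorem ConvergesFromDirection.comp {y : ℕ → E} {ybar v : E}
    (h : ConvergesFromDirection y ybar v) {σ : ℕ → ℕ} (hσ : StrictMono σ) :
    ConvergesFromDirection (y ∘ σ) ybar v := by
  obtain ⟨t, w, ht, ht0, hw, hy⟩ := h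
  exact ⟨t ∘ σ, w ∘ σ, fun k => ht _, ht0.comp hσ.tendsto_atTop, hw.comp hσ.tendsto_atTop,
    fun k => hy _⟩

theorem regularNormalCone_subset_limitingNormalCone (Ω : Set E) (x : E) :
    regularNormalCone Ω x ⊆ limitingNormalCone Ω x := fun z hz =>
  ⟨hz.1, fun _ => x, fun _ => z, tendsto_const_nhds, tendsto_const_nhds, fun _ => hz⟩

/-- A direction along which a whole initial segment stays in `Ω` is tangent. -/
theorem mem_bouligandCone_of_forall_small {Ω : Set E} {x d : E} (hx : x ∈ Ω)
    (h : ∀ᶠ t : ℝ in 𝓝[>] 0, x + t • d ∈ Ω) : d ∈ bouligandCone Ω x := by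
  have hseq : Tendsto (fun k : ℕ => 1 / ((k : ℝ) + 1)) atTop (𝓝[>] 0) :=
    tendsto_nhdsWithin_iff.2 ⟨tendsto_one_div_add_atTop_nhds_zero_nat,
      Eventually.of_forall fun k => Set.mem_Ioi.2 (by positivity)⟩
  obtain ⟨k₀, hk₀⟩ := eventually_atTop.1 (hseq.eventually h)
  refine ⟨hx, fun k => x + (1 / (((k + k₀ : ℕ) : ℝ) + 1)) • d, fun k => hk₀ _ (by omega),
    fun k => 1 / (((k + k₀ : ℕ) : ℝ) + 1), fun _ => d, fun k => by positivity, ?_,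
    tendsto_const_nhds, fun _ => rfl⟩
  exact (tendsto_nhdsWithin_iff.1 hseq).1.comp (tendsto_add_atTop_nat k₀)

theorem Convex.mem_regularNormalCone_iff {Q : Set E} (hQ : Convex ℝ Q) {q z : E} :
    z ∈ regularNormalCone Q q ↔ q ∈ Q ∧ ∀ p ∈ Q, inner ℝ z (p - q) ≤ 0 := by
  constructor
  · rintro ⟨hq, h⟩
    refine ⟨hq, fun p hp => h _ (mem_bouligandCone_of_forall_small hq ?_)⟩
    have : ∀ᶠ t : ℝ in 𝓝[>] 0, t ∈ Set.Ioc (0 : ℝ) 1 := Ioc_mem_nhdsGT one_pos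
    filter_upwards [this] with t ht
    exact hQ.add_smul_sub_mem hq hp ⟨ht.1.le, ht.2⟩
  · rintro ⟨hq, h⟩
    refine ⟨hq, ?_⟩
    rintro u ⟨-, y, hy, t, w, ht, -, hw, hyt⟩
    refine le_of_tendsto (tendsto_const_nhds.inner hw) (Eventually.of_forall fun k => ?_)
    have := h _ (hy k)
    rw [hyt k, add_sub_cancel_left, inner_smul_right] at this
    exact nonpos_of_mul_nonpos_right this (ht k)

theorem Convex.limitingNormalCone_eq {Q : Set E} (hQ : Convex ℝ Q) (q : E) :
    limitingNormalCone Q q = regularNormalCone Q q := by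
  refine Set.Subset.antisymm ?_ (regularNormalCone_subset_limitingNormalCone Q q)
  rintro z ⟨hq, y, w, hy, hw, hyw⟩
  refine hQ.mem_regularNormalCone_iff.2 ⟨hq, fun p hp => ?_⟩
  exact le_of_tendsto (hw.inner (tendsto_const_nhds.sub hy))
    (Eventually.of_forall fun k => (hQ.mem_regularNormalCone_iff.1 (hyw k)).2 p hp)

theorem Convex.clarkeRegularNear {Q : Set E} (hQ : Convex ℝ Q) (q : E) :
    ClarkeRegularNear Q q :=
  Eventually.of_forall fun p => (hQ.limitingNormalCone_eq p).symm

end ConvexSets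

/-! ### Finitely generated cones -/

section FiniteCones

variable {ι E : Type*} [NormedAddCommGroup E] [InnerProductSpace ℝ E]

/-- The convex cone generated by the vectors `a i`, `i ∈ s`. The coefficients are given on the whole
index type; those outside `s` play no role. -/
def generatedCone (a : ι → E) (s : Finset ι) : Set E :=
  {v | ∃ c : ι → ℝ, (∀ i, 0 ≤ c i) ∧ v = ∑ i ∈ s, c i • a i}

theorem smul_add_smul_mem_generatedCone {a : ι → E} {I : Finset ι} {v w : E}
    (hv : v ∈ generatedCone a I) (hw : w ∈ generatedCone a I) {α β : ℝ} (hα : 0 ≤ α) (hβ : 0 ≤ β) :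
    α • v + β • w ∈ generatedCone a I := by
  obtain ⟨c, hc, rfl⟩ := hv
  obtain ⟨d, hd, rfl⟩ := hw
  refine ⟨fun i => α * c i + β * d i, fun i => add_nonneg (mul_nonneg hα (hc i))
    (mul_nonneg hβ (hd i)), ?_⟩
  simp only [Finset.smul_sum, smul_smul, add_smul, Finset.sum_add_distrib]

theorem convex_generatedCone (a : ι → E) (s : Finset ι) : Convex ℝ (generatedCone a s) :=
  fun _ hv _ hw _ _ hα hβ _ => smul_add_smul_mem_generatedCone hv hw hα hβ

theorem generatedCone_mono (a : ι → E) {s t : Finset ι} (h : s ⊆ t) :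
    generatedCone a s ⊆ generatedCone a t := by
  classical
  rintro _ ⟨c, hc, rfl⟩
  refine ⟨fun i => if i ∈ s then c i else 0, fun i => ?_, ?_⟩
  · dsimp only; split_ifs
    exacts [hc i, le_rfl]
  · rw [← Finset.sum_subset h (f := fun i => (if i ∈ s then c i else 0) • a i)]
    · exact Finset.sum_congr rfl fun i hi => by simp [hi]
    · intro i _ hi; simp [hi]

/-- Carathéodory's reduction: with linearly dependent generators, every conic combination can do
without one of them. -/
theorem exists_mem_generatedCone_erase [DecidableEq ι] {a : ι → E} {s : Finset ι}
    (hs : ¬ LinearIndepOn ℝ a (s : Set ι)) {v : E} (hv : v ∈ generatedCone a s) :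
    ∃ i ∈ s, v ∈ generatedCone a (s.erase i) := by
  obtain ⟨c, hc, rfl⟩ := hv
  obtain ⟨μ, hμ, j, hj, hj0⟩ : ∃ μ : ι → ℝ, ∑ i ∈ s, μ i • a i = 0 ∧ ∃ j ∈ s, 0 < μ j := by
    rw [linearIndepOn_finset_iff] at hs
    push Not at hs
    obtain ⟨f, hf, j, hj, hj0⟩ := hs
    rcases lt_or_gt_of_ne hj0 with h | h
    · exact ⟨fun i => -f i, by simp [neg_smul, hf], j, hj, by simpa using h⟩
    · exact ⟨f, hf, j, hj, h⟩
  -- the step `c i / μ i` is the largest along `-μ` that keeps all the coefficients nonnegative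
  obtain ⟨i, hi, hmin⟩ := Finset.exists_min_image (s.filter fun i => 0 < μ i)
    (fun i => c i / μ i) ⟨j, by simp [hj, hj0]⟩
  simp only [Finset.mem_filter] at hi hmin
  have hstep : 0 ≤ c i / μ i := div_nonneg (hc i) hi.2.le
  refine ⟨i, hi.1, fun l => if l ∈ s then c l - c i / μ i * μ l else 0, fun l => ?_, ?_⟩
  · dsimp only
    split_ifs with hl
    · rcases lt_or_ge 0 (μ l) with h | h
      · have := (le_div_iff₀ h).1 (hmin l ⟨hl, h⟩)
        linarith
      · have := mul_nonpos_of_nonneg_of_nonpos hstep h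
        linarith [hc l]
    · exact le_rfl
  · have hzero : c i - c i / μ i * μ i = 0 := by
      rw [div_mul_cancel₀ _ hi.2.ne', sub_self]
    have hsum : ∑ l ∈ s, (if l ∈ s then c l - c i / μ i * μ l else 0) • a l
        = ∑ l ∈ s, c l • a l := by
      rw [Finset.sum_congr rfl (fun l hl => by rw [if_pos hl, sub_smul, mul_smul]),
        Finset.sum_sub_distrib, ← Finset.smul_sum, hμ, smul_zero, sub_zero]
    rw [← hsum, ← Finset.sum_erase_add _ _ hi.1, if_pos hi.1, hzero, zero_smul, add_zero]

theorem isClosed_generatedCone (a : ι → E) (s : Finset ι) : IsClosed (generatedCone a s) := by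
  classical
  induction s using Finset.strongInduction with
  | H s ih =>
    by_cases hs : LinearIndepOn ℝ a (s : Set ι)
    · -- the cone is the image of the orthant under an injective linear map
      let L : (s → ℝ) →ₗ[ℝ] E := Fintype.linearCombination ℝ (fun i : s => a i)
      have hL : Topology.IsClosedEmbedding L :=
        LinearMap.isClosedEmbedding_of_injective
          (LinearMap.ker_eq_bot.2 (LinearIndependent.fintypeLinearCombination_injective hs))
      have : generatedCone a s = L '' {c | ∀ i, 0 ≤ c i} := by
        ext v
        constructor
        · rintro ⟨c, hc, rfl⟩
          refine ⟨fun i => c i, fun i => hc i, ?_⟩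
          simp only [L, Fintype.linearCombination_apply]
          exact Finset.sum_coe_sort s fun i => c i • a i
        · rintro ⟨c, hc, rfl⟩
          refine ⟨fun i => if h : i ∈ s then c ⟨i, h⟩ else 0, fun i => ?_, ?_⟩
          · dsimp only; split_ifs
            exacts [hc _, le_rfl]
          · simp only [L, Fintype.linearCombination_apply]
            rw [← Finset.sum_coe_sort s]
            exact Finset.sum_congr rfl fun i _ => by simp
      rw [this]
      refine hL.isClosedMap _ ?_
      simp only [Set.ofPred_forall]
      exact isClosed_iInter fun i => isClosed_le continuous_const (continuous_apply i)
    · have : generatedCone a s = ⋃ i ∈ s, generatedCone a (s.erase i) := by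
        ext v
        simp only [Set.mem_iUnion, exists_prop]
        exact ⟨exists_mem_generatedCone_erase hs,
          fun ⟨i, _, h⟩ => generatedCone_mono a (Finset.erase_subset i s) h⟩
      rw [this]
      exact s.finite_toSet.isClosed_biUnion fun i hi => ih _ (Finset.erase_ssubset hi)

/-- Farkas' lemma: the cone generated by finitely many vectors contains its bipolar. -/
theorem mem_generatedCone_of_forall_inner_nonpos [CompleteSpace E] {a : ι → E} {s : Finset ι}
    {z : E} (h : ∀ d, (∀ i ∈ s, inner ℝ (a i) d ≤ 0) → inner ℝ z d ≤ 0) :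
    z ∈ generatedCone a s := by
  classical
  by_contra hz
  obtain ⟨f, u, hfu, huz⟩ := geometric_hahn_banach_closed_point (convex_generatedCone a s)
    (isClosed_generatedCone a s) hz
  have hu : 0 < u := by simpa using hfu 0 ⟨0, fun _ => le_rfl, by simp⟩
  have hfa : ∀ i ∈ s, f (a i) ≤ 0 := by
    intro i hi
    by_contra! hpos
    have hmem : (u / f (a i)) • a i ∈ generatedCone a s :=
      ⟨Pi.single i (u / f (a i)), fun j => by
        by_cases hj : j = i
        · subst hj; simp [(div_pos hu hpos).le]
        · simp [hj], by
        rw [Finset.sum_eq_single i] <;> simp +contextual [hi]⟩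
    have := hfu _ hmem
    rw [map_smul, smul_eq_mul, div_mul_cancel₀ _ hpos.ne'] at this
    exact lt_irrefl _ this
  have key := h ((InnerProductSpace.toDual ℝ E).symm f) fun i hi => by
    rw [real_inner_comm, InnerProductSpace.toDual_symm_apply]
    exact hfa i hi
  rw [real_inner_comm, InnerProductSpace.toDual_symm_apply] at key
  linarith

end FiniteCones

/-! ### Polyhedral sets -/

section Polyhedral

variable {ι E : Type*} [NormedAddCommGroup E] [InnerProductSpace ℝ E]

theorem convex_setOf_forall_inner_le (a : ι → E) (b : ι → ℝ) :
    Convex ℝ {z | ∀ i, inner ℝ (a i) z ≤ b i} := by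
  simp only [Set.ofPred_forall]
  exact convex_iInter fun i => convex_halfSpace_le
    ⟨fun x y => inner_add_right _ x y, fun c x => inner_smul_right _ x c⟩ _

theorem IsConvexPolyhedral.convex {D : Set E} (hD : IsConvexPolyhedral D) : Convex ℝ D := by
  obtain ⟨N, a, b, rfl⟩ := hD
  exact convex_setOf_forall_inner_le a b

/-- The indices of the constraints `⟪a i, z⟫ ≤ b i` that are active at `q`. -/
noncomputable def activeSet [Fintype ι] (a : ι → E) (b : ι → ℝ) (q : E) : Finset ι :=
  open Classical in Finset.univ.filter fun i => inner ℝ (a i) q = b i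

theorem mem_activeSet [Fintype ι] {a : ι → E} {b : ι → ℝ} {q : E} {i : ι} :
    i ∈ activeSet a b q ↔ inner ℝ (a i) q = b i := by
  simp [activeSet]

theorem eventually_activeSet_subset [Fintype ι] (a : ι → E) (b : ι → ℝ) (q : E) :
    ∀ᶠ p in 𝓝 q, activeSet a b p ⊆ activeSet a b q := by
  have : ∀ i, ∀ᶠ p in 𝓝 q, inner ℝ (a i) p = b i → inner ℝ (a i) q = b i := by
    intro i
    by_cases hi : inner ℝ (a i) q = b i
    · exact Eventually.of_forall fun _ _ => hi
    · have hc : ContinuousAt (fun p => inner ℝ (a i) p) q := by fun_prop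
      filter_upwards [hc.eventually_ne hi] with p hp h using absurd h hp
  filter_upwards [eventually_all.2 this] with p hp i hi
  exact mem_activeSet.2 (hp i (mem_activeSet.1 hi))

theorem bouligandCone_polyhedral [Fintype ι] {a : ι → E} {b : ι → ℝ} {q : E}
    (hq : ∀ i, inner ℝ (a i) q ≤ b i) :
    bouligandCone {z | ∀ i, inner ℝ (a i) z ≤ b i} q =
      {d | ∀ i ∈ activeSet a b q, inner ℝ (a i) d ≤ 0} := by
  ext d
  constructor
  · rintro ⟨-, y, hy, t, w, ht, -, hw, hyt⟩ i hi
    refine le_of_tendsto (tendsto_const_nhds.inner hw) (Eventually.of_forall fun k => ?_)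
    have h1 := hy k i
    rw [hyt k, inner_add_right, mem_activeSet.1 hi, inner_smul_right] at h1
    exact nonpos_of_mul_nonpos_right (by linarith) (ht k)
  · intro hd
    refine mem_bouligandCone_of_forall_small hq ?_
    refine eventually_all.2 fun i => ?_
    by_cases hi : i ∈ activeSet a b q
    · filter_upwards [self_mem_nhdsWithin] with t ht
      rw [inner_add_right, inner_smul_right]
      have := mul_nonpos_of_nonneg_of_nonpos (Set.mem_Ioi.1 ht).le (hd i hi)
      linarith [hq i]
    · have hlt : inner ℝ (a i) q < b i := lt_of_le_of_ne (hq i) (mt mem_activeSet.2 hi)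
      have hc : ContinuousAt (fun t : ℝ => inner ℝ (a i) (q + t • d)) 0 := by fun_prop
      have : ∀ᶠ t in 𝓝 (0 : ℝ), inner ℝ (a i) (q + t • d) < b i :=
        hc.eventually_lt_const (by simpa using hlt)
      filter_upwards [nhdsWithin_le_nhds this] with t ht using ht.le

theorem mem_limitingNormalCone_polyhedral_iff [Fintype ι] {a : ι → E} {b : ι → ℝ} {q z : E} :
    z ∈ limitingNormalCone {z | ∀ i, inner ℝ (a i) z ≤ b i} q ↔ (∀ i, inner ℝ (a i) q ≤ b i) ∧
      ∀ d, (∀ i ∈ activeSet a b q, inner ℝ (a i) d ≤ 0) → inner ℝ z d ≤ 0 := by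
  rw [(convex_setOf_forall_inner_le a b).limitingNormalCone_eq]
  refine and_congr_right fun hq => ?_
  rw [bouligandCone_polyhedral hq]
  rfl

/-- The normal cone to a polyhedral set is generated by the active constraint vectors. -/
theorem limitingNormalCone_polyhedral_eq [Fintype ι] [CompleteSpace E] {a : ι → E} {b : ι → ℝ}
    {q : E} (hq : ∀ i, inner ℝ (a i) q ≤ b i) :
    limitingNormalCone {z | ∀ i, inner ℝ (a i) z ≤ b i} q =
      generatedCone a (activeSet a b q) := by
  ext z
  rw [mem_limitingNormalCone_polyhedral_iff]
  constructor
  · exact fun h => mem_generatedCone_of_forall_inner_nonpos h.2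
  · rintro ⟨c, hc, rfl⟩
    refine ⟨hq, fun d hd => ?_⟩
    rw [sum_inner]
    refine Finset.sum_nonpos fun i hi => ?_
    rw [real_inner_smul_left]
    exact mul_nonpos_of_nonneg_of_nonpos (hc i) (hd i hi)

/-- If `y k ∈ Q` converges to `q` from direction `d`, then the normals to `Q` at `y k` are
eventually normals in direction `d`: only constraints with `⟪a i, d⟫ = 0` can be active at `y k`. -/
theorem eventually_limitingNormalCone_subset [Fintype ι] {a : ι → E} {b : ι → ℝ} {q d : E}
    (hq : ∀ i, inner ℝ (a i) q ≤ b i) {y : ℕ → E} (hy : ∀ k i, inner ℝ (a i) (y k) ≤ b i)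
    (hyd : ConvergesFromDirection y q d) :
    ∀ᶠ k in atTop, limitingNormalCone {z | ∀ i, inner ℝ (a i) z ≤ b i} (y k) ⊆
      limitingNormalCone (bouligandCone {z | ∀ i, inner ℝ (a i) z ≤ b i} q) d := by
  have hdT : d ∈ bouligandCone {z | ∀ i, inner ℝ (a i) z ≤ b i} q := ⟨hq, y, hy, hyd⟩
  have hev := hyd.tendsto.eventually (eventually_activeSet_subset a b q)
  obtain ⟨t, w, ht, -, hw, hyt⟩ := hyd
  have hzero := hw.eventually (eventually_activeSet_subset a 0 d)
  filter_upwards [hev, hzero] with k hk hk0 z hz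
  -- the tangent cone is polyhedral itself, given by the constraints that are active at `q`
  have hT : bouligandCone {z | ∀ i, inner ℝ (a i) z ≤ b i} q =
      {v | ∀ i : activeSet a b q, inner ℝ (a i) v ≤ (fun _ => (0 : ℝ)) i} := by
    rw [bouligandCone_polyhedral hq]
    ext v; simp
  rw [hT] at hdT ⊢
  refine mem_limitingNormalCone_polyhedral_iff.2 ⟨hdT, fun v hv => ?_⟩
  refine (mem_limitingNormalCone_polyhedral_iff.1 hz).2 v fun i hi => ?_
  have hiq := hk hi
  refine hv ⟨i, hiq⟩ (mem_activeSet.2 ?_)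
  have h1 := mem_activeSet.1 hi
  rw [hyt k, inner_add_right, mem_activeSet.1 hiq, inner_smul_right] at h1
  have h2 : inner ℝ (a i) (w k) = 0 := by
    have : t k * inner ℝ (a i) (w k) = 0 := by linarith
    exact (mul_eq_zero.1 this).resolve_left (ht k).ne'
  exact mem_activeSet.1 (hk0 (mem_activeSet.2 h2))

end Polyhedral

/-! ### A smooth approximation of the norm -/

section SmoothNorm

variable {E : Type*} [NormedAddCommGroup E]

/-- A smooth approximation of the norm, from above and within `δ`. -/
noncomputable def smoothNorm (δ : ℝ) (v : E) : ℝ := √(‖v‖ ^ 2 + δ ^ 2)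

theorem norm_le_smoothNorm (δ : ℝ) (v : E) : ‖v‖ ≤ smoothNorm δ v :=
  Real.le_sqrt_of_sq_le (by nlinarith [sq_nonneg δ])

theorem smoothNorm_pos {δ : ℝ} (hδ : 0 < δ) (v : E) : 0 < smoothNorm δ v :=
  Real.sqrt_pos.2 (by positivity)

theorem smoothNorm_zero {δ : ℝ} (hδ : 0 < δ) : smoothNorm δ (0 : E) = δ := by
  simp [smoothNorm, hδ.le]

theorem continuous_smoothNorm (δ : ℝ) : Continuous (smoothNorm δ : E → ℝ) := by
  unfold smoothNorm; fun_prop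

theorem norm_inv_smoothNorm_smul_le [NormedSpace ℝ E] {δ : ℝ} (hδ : 0 < δ) (v : E) :
    ‖(smoothNorm δ v)⁻¹ • v‖ ≤ 1 := by
  have h := smoothNorm_pos hδ v
  rw [norm_smul, norm_inv, Real.norm_of_nonneg h.le, inv_mul_le_one₀ h]
  exact norm_le_smoothNorm δ v

theorem hasFDerivAt_smoothNorm [InnerProductSpace ℝ E] {δ : ℝ} (hδ : 0 < δ) (v : E) :
    HasFDerivAt (smoothNorm δ) (innerSL ℝ ((smoothNorm δ v)⁻¹ • v)) v := by
  have h1 : HasFDerivAt (fun v : E => ‖v‖ ^ 2 + δ ^ 2) (2 • innerSL ℝ v) v :=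
    (hasStrictFDerivAt_norm_sq v).hasFDerivAt.add_const _
  have h2 := h1.sqrt (by positivity)
  refine h2.congr_fderiv ?_
  ext w
  simp [smoothNorm]
  ring

end SmoothNorm

theorem tendsto_clm_apply {E F : Type*} [NormedAddCommGroup E] [NormedSpace ℝ E]
    [NormedAddCommGroup F] [NormedSpace ℝ F] {A : ℕ → E →L[ℝ] F} {A' : E →L[ℝ] F} {v : ℕ → E}
    {v' : E} (hA : Tendsto A atTop (𝓝 A')) (hv : Tendsto v atTop (𝓝 v')) :
    Tendsto (fun k => A k (v k)) atTop (𝓝 (A' v')) :=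
  (isBoundedBilinearMap_apply.continuous.tendsto _).comp (hA.prodMk_nhds hv)

/-! ### The multiplier rule under metric subregularity -/

section ExactPenalty

variable {E F : Type*} [NormedAddCommGroup E] [InnerProductSpace ℝ E] [FiniteDimensional ℝ E]
  [NormedAddCommGroup F] [InnerProductSpace ℝ F] [FiniteDimensional ℝ F]

/-- Polars of tangent cones are Fréchet normals: `⟪z, x - xbar⟫ ≤ o(‖x - xbar‖)` on `C`. -/
theorem eventually_inner_le_of_mem_regularNormalCone {C : Set E} {xbar z : E}
    (hz : z ∈ regularNormalCone C xbar) {ε : ℝ} (hε : 0 < ε) :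
    ∀ᶠ x in 𝓝 xbar, x ∈ C → inner ℝ z (x - xbar) ≤ ε * ‖x - xbar‖ := by
  by_contra hcon
  have hfreq : ∃ᶠ x in 𝓝 xbar, x ∈ C ∧ ε * ‖x - xbar‖ < inner ℝ z (x - xbar) := by
    refine (not_eventually.1 hcon).mono fun x hx => ?_
    simpa using hx
  obtain ⟨y, hy, hyC⟩ := exists_seq_forall_of_frequently hfreq
  have hpos : ∀ k, 0 < ‖y k - xbar‖ := by
    intro k
    refine norm_pos_iff.2 fun h0 => ?_
    have := (hyC k).2
    simp [h0] at this
  obtain ⟨u, -, σ, hσ, hu⟩ := (isCompact_sphere (0 : E) 1).tendsto_subseq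
    (x := fun k => ‖y k - xbar‖⁻¹ • (y k - xbar)) fun k => by
      simp [norm_smul, (hpos k).ne']
  have hdist : Tendsto (fun k => ‖y k - xbar‖) atTop (𝓝 0) :=
    tendsto_iff_norm_sub_tendsto_zero.1 hy
  have huT : u ∈ bouligandCone C xbar :=
    ⟨hz.1, y ∘ σ, fun k => (hyC _).1, fun k => ‖y (σ k) - xbar‖, _, fun k => hpos _,
      hdist.comp hσ.tendsto_atTop, hu, fun k => by simp [smul_smul, (hpos _).ne']⟩
  have hle : ε ≤ inner ℝ z u := by
    refine ge_of_tendsto (tendsto_const_nhds.inner hu) (Eventually.of_forall fun k => ?_)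
    simp only [Function.comp_apply, inner_smul_right]
    rw [inv_mul_eq_div, le_div_iff₀ (hpos _)]
    exact (hyC (σ k)).2.le
  linarith [hz.2 u huT]

/-- Exact penalization: under metric subregularity, the Fréchet inequality for a normal to
`φ ⁻¹' Q` extends to all of a neighbourhood, at the price of a multiple of `‖φ x - q‖`. -/
theorem eventually_inner_le_add_penalty {F : Type*} [NormedAddCommGroup F] {φ : E → F}
    (hφ : Continuous φ) {Q : Set F}
    (hQ : IsClosed Q) {κ : ℝ} {xbar z : E}
    (hM : ∀ᶠ x in 𝓝 xbar, ∀ q ∈ Q, Metric.infDist x (φ ⁻¹' Q) ≤ κ * ‖φ x - q‖)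
    (hz : z ∈ regularNormalCone (φ ⁻¹' Q) xbar) {ε : ℝ} (hε : 0 < ε) :
    ∀ᶠ x in 𝓝 xbar, ∀ q ∈ Q,
      inner ℝ z (x - xbar) ≤ κ * (‖z‖ + ε) * ‖φ x - q‖ + ε * ‖x - xbar‖ := by
  obtain ⟨r, hr, hball⟩ := Metric.eventually_nhds_iff_ball.1
    (eventually_inner_le_of_mem_regularNormalCone hz hε)
  filter_upwards [hM, Metric.ball_mem_nhds xbar (half_pos hr)] with x hx hxr q hq
  obtain ⟨p, hpC, hp⟩ := (hQ.preimage hφ).exists_infDist_eq_dist ⟨xbar, hz.1⟩ x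
  have hpx : ‖x - p‖ ≤ κ * ‖φ x - q‖ := by
    rw [← dist_eq_norm, ← hp]; exact hx q hq
  have hpx' : dist x p ≤ dist x xbar := by
    rw [← hp]; exact Metric.infDist_le_dist_of_mem hz.1
  have hpr : p ∈ Metric.ball xbar r := by
    rw [Metric.mem_ball] at hxr ⊢
    have := dist_triangle_left p xbar x
    linarith
  have h1 := hball p hpr hpC
  have h2 : inner ℝ z (x - p) ≤ ‖z‖ * ‖x - p‖ := real_inner_le_norm _ _
  have h3 : ‖p - xbar‖ ≤ ‖x - p‖ + ‖x - xbar‖ := by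
    have := dist_triangle_left p xbar x
    simpa [dist_eq_norm] using this
  have h4 : inner ℝ z (x - xbar) = inner ℝ z (x - p) + inner ℝ z (p - xbar) := by
    rw [← inner_add_right]; congr 1; abel
  have h5 := mul_le_mul_of_nonneg_left hpx (add_nonneg (norm_nonneg z) hε.le)
  have h6 := mul_le_mul_of_nonneg_left h3 hε.le
  nlinarith

/-- If `q` minimizes the smoothed distance to `p` over `Q` near `q`, then the vector from `q`
to `p` is a regular normal to `Q` at `q`. -/
theorem smul_sub_mem_regularNormalCone {F : Type*} [NormedAddCommGroup F]
    [InnerProductSpace ℝ F] {Q : Set F} {p q : F} (hq : q ∈ Q) {δ c : ℝ} (hc : 0 ≤ c)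
    (hmin : ∀ᶠ q' in 𝓝 q, q' ∈ Q → smoothNorm δ (p - q) ≤ smoothNorm δ (p - q')) :
    c • (p - q) ∈ regularNormalCone Q q := by
  refine ⟨hq, ?_⟩
  rintro u ⟨-, y, hy, hyu⟩
  have hev := hyu.tendsto.eventually hmin
  obtain ⟨t, w, ht, ht0, hw, hyt⟩ := hyu
  have hlim : Tendsto (fun k => t k * ‖w k‖ ^ 2 - 2 * inner ℝ (p - q) (w k)) atTop
      (𝓝 (0 * ‖u‖ ^ 2 - 2 * inner ℝ (p - q) u)) :=
    (ht0.mul (hw.norm.pow 2)).sub ((tendsto_const_nhds.inner hw).const_mul 2)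
  have hge : 0 ≤ 0 * ‖u‖ ^ 2 - 2 * inner ℝ (p - q) u := by
    refine ge_of_tendsto hlim (hev.mono fun k hk => ?_)
    have h1 := hk (hy k)
    rw [smoothNorm, smoothNorm, Real.sqrt_le_sqrt_iff (by positivity), hyt k, ← sub_sub,
      norm_sub_sq_real (p - q), inner_smul_right, norm_smul, mul_pow,
      Real.norm_of_nonneg (ht k).le] at h1
    have h2 : 0 ≤ t k * (t k * ‖w k‖ ^ 2 - 2 * inner ℝ (p - q) (w k)) := by nlinarith
    exact nonneg_of_mul_nonneg_right h2 (ht k)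
  rw [real_inner_smul_left]
  exact mul_nonpos_of_nonneg_of_nonpos hc (by linarith)

/-- Fuzzy multiplier rule: up to an arbitrarily small error, a regular normal to `φ ⁻¹' Q` is
the image of a regular normal to `Q`, with norm controlled by the subregularity modulus. -/
theorem exists_approx_multiplier {φ : E → F} (hφ : Differentiable ℝ φ) {Q : Set F}
    (hQ : IsClosed Q) {κ : ℝ} (hκ : 0 < κ) {xbar z : E}
    (hM : ∀ᶠ x in 𝓝 xbar, ∀ q ∈ Q, Metric.infDist x (φ ⁻¹' Q) ≤ κ * ‖φ x - q‖)
    (hz : z ∈ regularNormalCone (φ ⁻¹' Q) xbar) {ε : ℝ} (hε : 0 < ε) :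
    ∃ (x : E) (q lam : F), ‖x - xbar‖ ≤ ε ∧ ‖q - φ xbar‖ ≤ ε ∧ lam ∈ regularNormalCone Q q ∧
      ‖lam‖ ≤ κ * (‖z‖ + ε) + ε ∧ ‖ContinuousLinearMap.adjoint (fderiv ℝ φ x) lam - z‖ ≤ 2 * ε := by
  have hφc : ∀ᶠ x in 𝓝 xbar, ‖φ x - φ xbar‖ < ε / 2 := by
    have := hφ.continuous.continuousAt.eventually (Metric.ball_mem_nhds (φ xbar) (half_pos hε))
    simpa [dist_eq_norm] using this
  obtain ⟨r, hr, hball⟩ := Metric.nhds_basis_closedBall.eventually_iff.1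
    ((eventually_inner_le_add_penalty hφ.continuous hQ hM hz hε).and hφc)
  set ρ := min r ε with hρ
  have hρ0 : 0 < ρ := lt_min hr hε
  -- the extra `ε` forces minimizers to have `‖φ x - q‖` small, as `2 * ε` below does for
  -- `‖x - xbar‖`
  set L := κ * (‖z‖ + ε) + ε with hL
  have hL0 : 0 < L := by positivity
  -- small enough that the minimizers below lie in the interior of the constraint balls
  set δ := ε * ρ / (4 * (L + 2 * ε)) with hδdef
  have hδ : 0 < δ := by positivity
  have hδeq : (L + 2 * ε) * δ = ε * (ρ / 4) := by rw [hδdef]; field_simp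
  let f : E × F → ℝ := fun p =>
    -inner ℝ z (p.1 - xbar) + L * smoothNorm δ (φ p.1 - p.2) + 2 * ε * smoothNorm δ (p.1 - xbar)
  have hf : Continuous f := by
    have h1 := hφ.continuous
    have h2 : Continuous fun p : E × F => smoothNorm δ (φ p.1 - p.2) :=
      (continuous_smoothNorm δ).comp (by fun_prop)
    have h3 : Continuous fun p : E × F => smoothNorm δ (p.1 - xbar) :=
      (continuous_smoothNorm δ).comp (by fun_prop)
    fun_prop
  have hqbar : φ xbar ∈ Q := hz.1
  obtain ⟨⟨x, q⟩, ⟨hxr, hq, hqε⟩, hmin⟩ :=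
    ((isCompact_closedBall xbar ρ).prod
      ((isCompact_closedBall (φ xbar) ε).inter_left hQ)).exists_isMinOn
      ⟨(xbar, φ xbar), by simp [hρ0.le, hε.le, hqbar]⟩ hf.continuousOn
  simp only at hxr hq hqε
  have hx' := hball (Metric.closedBall_subset_closedBall (min_le_left _ _) hxr)
  have hfle : f (x, q) ≤ (L + 2 * ε) * δ := by
    have := hmin (a := (xbar, φ xbar)) (by simp [hρ0.le, hε.le, hqbar])
    simp only [f, sub_self, inner_zero_right, smoothNorm_zero hδ, Set.mem_ofPred_eq] at this
    simp only [f]; linarith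
  have hlow : ε * ‖x - xbar‖ + ε * ‖φ x - q‖ ≤ ε * (ρ / 4) := by
    have h1 := hx'.1 q hq
    have h2 := mul_le_mul_of_nonneg_left (norm_le_smoothNorm δ (φ x - q)) hL0.le
    have h3 := mul_le_mul_of_nonneg_left (norm_le_smoothNorm δ (x - xbar))
      (by positivity : 0 ≤ 2 * ε)
    rw [hδeq] at hfle
    simp only [f] at hfle
    rw [hL, add_mul] at h2
    linarith
  have hlow' : ‖x - xbar‖ + ‖φ x - q‖ ≤ ρ / 4 := by
    rw [← mul_add] at hlow; exact le_of_mul_le_mul_left hlow hε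
  have hρε : ρ ≤ ε := min_le_right _ _
  have hxlt : ‖x - xbar‖ < ρ := by linarith [norm_nonneg (φ x - q)]
  have hqlt : ‖q - φ xbar‖ < ε := by
    have h1 : ‖q - φ xbar‖ ≤ ‖φ x - q‖ + ‖φ x - φ xbar‖ := by
      have := dist_triangle_left q (φ xbar) (φ x)
      simpa [dist_eq_norm] using this
    linarith [hx'.2, norm_nonneg (x - xbar)]
  set s := smoothNorm δ (φ x - q)
  have hs0 : 0 < s := smoothNorm_pos hδ _
  refine ⟨x, q, (L * s⁻¹) • (φ x - q), hxlt.le.trans hρε, hqlt.le, ?_, ?_, ?_⟩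
  · refine smul_sub_mem_regularNormalCone (δ := δ) hq (by positivity) ?_
    have hnear : ∀ᶠ q' in 𝓝 q, q' ∈ Metric.closedBall (φ xbar) ε :=
      Metric.closedBall_mem_nhds_of_mem (by simpa [dist_eq_norm] using hqlt)
    filter_upwards [hnear] with q' hq' hq'Q
    have := hmin (a := (x, q')) ⟨hxr, hq'Q, hq'⟩
    simp only [f, Set.mem_ofPred_eq] at this
    exact le_of_mul_le_mul_left (by linarith) hL0
  · rw [mul_smul, norm_smul, Real.norm_of_nonneg hL0.le]
    exact mul_le_of_le_one_right hL0.le (norm_inv_smoothNorm_smul_le hδ _)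
  · -- Fermat's rule for `x ↦ f (x, q)`
    have hloc : IsLocalMin (fun x' => f (x', q)) x := by
      have hnear : ∀ᶠ x' in 𝓝 x, x' ∈ Metric.closedBall xbar ρ :=
        Metric.closedBall_mem_nhds_of_mem (by simpa [dist_eq_norm] using hxlt)
      filter_upwards [hnear] with x' hx'
      exact hmin (a := (x', q)) ⟨hx', hq, hqε⟩
    have hd1 : HasFDerivAt (fun x' => inner ℝ z (x' - xbar)) (innerSL ℝ z) x :=
      (innerSL ℝ z).hasFDerivAt.comp x ((hasFDerivAt_id x).sub_const xbar)
    have hd2 := (hasFDerivAt_smoothNorm hδ (φ x - q)).comp x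
      ((hφ x).hasFDerivAt.sub_const q)
    have hd3 := (hasFDerivAt_smoothNorm hδ (x - xbar)).comp x
      ((hasFDerivAt_id x).sub_const xbar)
    have hzero := hloc.hasFDerivAt_eq_zero
      ((hd1.neg.add (hd2.const_mul L)).add (hd3.const_mul (2 * ε)))
    have hgrad : ContinuousLinearMap.adjoint (fderiv ℝ φ x) ((L * s⁻¹) • (φ x - q)) - z =
        -((2 * ε) • ((smoothNorm δ (x - xbar))⁻¹ • (x - xbar))) := by
      refine ext_inner_right ℝ fun v => ?_
      have := DFunLike.congr_fun hzero v
      simp only [add_apply, neg_apply,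
        smul_apply, ContinuousLinearMap.comp_apply, innerSL_apply_apply,
        zero_apply, smul_eq_mul, real_inner_smul_left,
        ContinuousLinearMap.id_apply] at this
      rw [inner_sub_left, ContinuousLinearMap.adjoint_inner_left, inner_neg_left]
      simp only [real_inner_smul_left]
      linarith
    rw [hgrad, norm_neg, norm_smul, Real.norm_of_nonneg (by positivity)]
    exact mul_le_of_le_one_right (by positivity) (norm_inv_smoothNorm_smul_le hδ _)

/-- Under metric subregularity with modulus `κ`, every regular normal `z` to `φ ⁻¹' Q` has a
multiplier of norm at most `κ * ‖z‖`. -/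
theorem exists_multiplier_norm_le {φ : E → F} (hφ : ContDiff ℝ 1 φ) {Q : Set F}
    (hQ : IsClosed Q) {κ : ℝ} (hκ : 0 < κ) {xbar z : E}
    (hM : ∀ᶠ x in 𝓝 xbar, ∀ q ∈ Q, Metric.infDist x (φ ⁻¹' Q) ≤ κ * ‖φ x - q‖)
    (hz : z ∈ regularNormalCone (φ ⁻¹' Q) xbar) :
    ∃ lam ∈ limitingNormalCone Q (φ xbar),
      ContinuousLinearMap.adjoint (fderiv ℝ φ xbar) lam = z ∧ ‖lam‖ ≤ κ * ‖z‖ := by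
  have hε : ∀ k : ℕ, 0 < 1 / ((k : ℝ) + 1) := fun k => by positivity
  have hε0 : Tendsto (fun k : ℕ => 1 / ((k : ℝ) + 1)) atTop (𝓝 0) :=
    tendsto_one_div_add_atTop_nhds_zero_nat
  choose x q lam hx hq hlam hnorm hadj using fun k =>
    exists_approx_multiplier (hφ.differentiable one_ne_zero) hQ hκ hM hz (hε k)
  have hbound : ∀ k, lam k ∈ Metric.closedBall (0 : F) (κ * (‖z‖ + 1) + 1) := by
    intro k
    have h1 : 1 / ((k : ℝ) + 1) ≤ 1 := by
      rw [div_le_one (by positivity)]; linarith [(Nat.cast_nonneg k : (0 : ℝ) ≤ k)]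
    rw [mem_closedBall_zero_iff]
    refine (hnorm k).trans ?_
    gcongr
  obtain ⟨l, -, σ, hσ, hl⟩ := (isCompact_closedBall (0 : F) _).tendsto_subseq hbound
  have hxlim : Tendsto x atTop (𝓝 xbar) :=
    tendsto_iff_norm_sub_tendsto_zero.2 (squeeze_zero (fun _ => norm_nonneg _) hx hε0)
  have hqlim : Tendsto q atTop (𝓝 (φ xbar)) :=
    tendsto_iff_norm_sub_tendsto_zero.2 (squeeze_zero (fun _ => norm_nonneg _) hq hε0)
  have hσt := hσ.tendsto_atTop
  refine ⟨l, ⟨hz.1, q ∘ σ, lam ∘ σ, hqlim.comp hσt, hl, fun k => hlam _⟩, ?_, ?_⟩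
  · have hD : Tendsto (fun k => ContinuousLinearMap.adjoint (fderiv ℝ φ (x k))) atTop
        (𝓝 (ContinuousLinearMap.adjoint (fderiv ℝ φ xbar))) :=
      (ContinuousLinearMap.adjoint.continuous.tendsto _).comp
        (((hφ.continuous_fderiv one_ne_zero).tendsto xbar).comp hxlim)
    have h1 : Tendsto (fun k => ContinuousLinearMap.adjoint (fderiv ℝ φ (x (σ k))) (lam (σ k)))
        atTop (𝓝 (ContinuousLinearMap.adjoint (fderiv ℝ φ xbar) l)) :=
      tendsto_clm_apply (hD.comp hσt) hl
    have h2 : Tendsto (fun k => ContinuousLinearMap.adjoint (fderiv ℝ φ (x k)) (lam k))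
        atTop (𝓝 z) := by
      refine tendsto_iff_norm_sub_tendsto_zero.2
        (squeeze_zero (fun _ => norm_nonneg _) hadj ?_)
      simpa using hε0.const_mul 2
    exact tendsto_nhds_unique h1 (h2.comp hσt)
  · have h1 : Tendsto (fun k : ℕ => κ * (‖z‖ + 1 / ((k : ℝ) + 1)) + 1 / ((k : ℝ) + 1)) atTop
        (𝓝 (κ * (‖z‖ + 0) + 0)) := ((hε0.const_add ‖z‖).const_mul κ).add hε0
    simpa using le_of_tendsto_of_tendsto hl.norm (h1.comp hσt)
      (Eventually.of_forall fun k => hnorm _)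

end ExactPenalty

/-! ### Images under differentiable maps -/

section Directional

variable {E F : Type*} [NormedAddCommGroup E] [InnerProductSpace ℝ E]
  [NormedAddCommGroup F] [InnerProductSpace ℝ F]

/-- Difference quotients along a sequence from direction `v` converge to the derivative
along `v`. -/
theorem HasFDerivAt.tendsto_inv_smul_sub {G : Type*} [NormedAddCommGroup G] [NormedSpace ℝ G]
    {f : E → G} {f' : E →L[ℝ] G} {x v : E} (hf : HasFDerivAt f f' x) {t : ℕ → ℝ} {w : ℕ → E}
    (ht : ∀ k, 0 < t k) (ht0 : Tendsto t atTop (𝓝 0)) (hw : Tendsto w atTop (𝓝 v)) :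
    Tendsto (fun k => (t k)⁻¹ • (f (x + t k • w k) - f x)) atTop (𝓝 (f' v)) := by
  refine hf.hasFDerivWithinAt.lim (s := Set.univ) (by simpa using ht0.smul hw)
    (Eventually.of_forall fun _ => trivial) (hw.congr fun k => ?_)
  rw [smul_smul, inv_mul_cancel₀ (ht k).ne', one_smul]

theorem ConvergesFromDirection.map {f : E → F} {f' : E →L[ℝ] F} {x v : E}
    (hf : HasFDerivAt f f' x) {y : ℕ → E} (hy : ConvergesFromDirection y x v) :
    ConvergesFromDirection (f ∘ y) (f x) (f' v) := by
  obtain ⟨t, w, ht, ht0, hw, hyt⟩ := hy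
  refine ⟨t, _, ht, ht0, hf.tendsto_inv_smul_sub ht ht0 hw, fun k => ?_⟩
  rw [smul_smul, mul_inv_cancel₀ (ht k).ne', one_smul, ← hyt k, Function.comp_apply,
    add_sub_cancel]

theorem adjoint_mem_regularNormalCone_preimage [CompleteSpace E] [CompleteSpace F] {φ : E → F}
    {x : E} (hφ : DifferentiableAt ℝ φ x) {Q : Set F} {lam : F}
    (hlam : lam ∈ regularNormalCone Q (φ x)) :
    ContinuousLinearMap.adjoint (fderiv ℝ φ x) lam ∈ regularNormalCone (φ ⁻¹' Q) x := by
  refine ⟨hlam.1, ?_⟩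
  rintro u ⟨-, y, hy, hyu⟩
  rw [ContinuousLinearMap.adjoint_inner_left]
  exact hlam.2 _ ⟨hlam.1, φ ∘ y, hy, hyu.map hφ.hasFDerivAt⟩

end Directional

/-! ### Bounded multipliers and inner semicompactness -/

section MultiplierMap

variable {n m : ℕ} {φ : EuclideanSpace ℝ (Fin n) → EuclideanSpace ℝ (Fin m)}
  {Q : Set (EuclideanSpace ℝ (Fin m))} {x xstar : EuclideanSpace ℝ (Fin n)}

theorem MetricallySubregularAt.eventually_infDist_le
    (hM : MetricallySubregularAt (constraintMap φ Q) x 0) :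
    ∃ κ : ℝ, 0 < κ ∧ ∀ᶠ x' in 𝓝 x, ∀ q ∈ Q,
      Metric.infDist x' (φ ⁻¹' Q) ≤ κ * ‖φ x' - q‖ := by
  obtain ⟨-, κ, hκ, hev⟩ := hM
  refine ⟨κ, hκ, hev.mono fun x' hx' q hq => ?_⟩
  have hpre : {z | (0 : EuclideanSpace ℝ (Fin m)) ∈ constraintMap φ Q z} = φ ⁻¹' Q := by
    ext z
    constructor
    · rintro ⟨p, hp, h⟩
      rw [Set.mem_preimage, sub_eq_zero.1 h.symm]; exact hp
    · exact fun h => ⟨φ z, h, (sub_self _).symm⟩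
  have h1 : Metric.infEDist (0 : EuclideanSpace ℝ (Fin m)) (constraintMap φ Q x') ≤
      ENNReal.ofReal ‖φ x' - q‖ := by
    have hmem : φ x' - q ∈ constraintMap φ Q x' := ⟨q, hq, rfl⟩
    refine (Metric.infEDist_le_edist_of_mem hmem).trans ?_
    rw [edist_dist, dist_zero_left]
  rw [hpre] at hx'
  have h2 : Metric.infEDist x' (φ ⁻¹' Q) ≤ ENNReal.ofReal (κ * ‖φ x' - q‖) := by
    rw [ENNReal.ofReal_mul hκ.le]
    exact hx'.trans (mul_le_mul_right h1 _)
  exact ENNReal.toReal_le_of_le_ofReal (by positivity) h2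

/-- Metric subregularity at `x` and Clarke regularity of `Q` provide uniformly bounded
multipliers for all pairs in `dom Λ` near `(x, xstar)`. -/
theorem exists_eventually_bounded_multiplier (hφ : ContDiff ℝ 1 φ) (hQ : IsClosed Q)
    (hM : MetricallySubregularAt (constraintMap φ Q) x 0) (hreg : ClarkeRegularNear Q (φ x)) :
    ∃ B : ℝ, 0 < B ∧ ∀ᶠ p in 𝓝 (WithLp.toLp 2 (x, xstar)), p ∈ svDom (multiplierMap φ Q) →
      ∃ lam ∈ multiplierMap φ Q p, ‖lam‖ ≤ B := by
  obtain ⟨κ, hκ, hev⟩ := hM.eventually_infDist_le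
  refine ⟨κ * (‖xstar‖ + 1), by positivity, ?_⟩
  have hfst : Tendsto (fun p : WithLp 2 (EuclideanSpace ℝ (Fin n) × EuclideanSpace ℝ (Fin n)) =>
      p.fst) (𝓝 (WithLp.toLp 2 (x, xstar))) (𝓝 x) :=
    Continuous.tendsto' (by fun_prop) _ _ rfl
  have hsnd : Tendsto (fun p : WithLp 2 (EuclideanSpace ℝ (Fin n) × EuclideanSpace ℝ (Fin n)) =>
      p.snd) (𝓝 (WithLp.toLp 2 (x, xstar))) (𝓝 xstar) :=
    Continuous.tendsto' (by fun_prop) _ _ rfl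
  filter_upwards [hfst.eventually hev.eventually_nhds,
    ((hφ.continuous.tendsto x).comp hfst).eventually hreg,
    hsnd.norm.eventually_le_const (lt_add_one ‖xstar‖)] with p hp hpreg hpn hdom
  obtain ⟨mu, hmu, hmup⟩ := hdom
  have hz : p.snd ∈ regularNormalCone (φ ⁻¹' Q) p.fst := by
    rw [← hmup]
    refine adjoint_mem_regularNormalCone_preimage (hφ.differentiable one_ne_zero _) ?_
    exact hpreg ▸ hmu
  obtain ⟨lam, hlam, hadj, hn⟩ := exists_multiplier_norm_le hφ hQ hκ hp hz
  exact ⟨lam, ⟨hlam, hadj⟩, hn.trans (by gcongr)⟩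

/-- Along sequences in `dom Λ` there are convergent multipliers, bounded by a constant that does
not depend on the sequence. -/
theorem exists_convergent_multipliers (hφ : ContDiff ℝ 1 φ) (hQ : IsClosed Q)
    (hM : MetricallySubregularAt (constraintMap φ Q) x 0) (hreg : ClarkeRegularNear Q (φ x)) :
    ∃ B : ℝ, 0 < B ∧
      ∀ y : ℕ → WithLp 2 (EuclideanSpace ℝ (Fin n) × EuclideanSpace ℝ (Fin n)),
        (∀ k, y k ∈ svDom (multiplierMap φ Q)) →
        Tendsto y atTop (𝓝 (WithLp.toLp 2 (x, xstar))) →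
        ∃ (σ : ℕ → ℕ) (lam : ℕ → EuclideanSpace ℝ (Fin m)) (l : EuclideanSpace ℝ (Fin m)),
          StrictMono σ ∧ (∀ j, lam j ∈ multiplierMap φ Q (y (σ j))) ∧ (∀ j, ‖lam j‖ ≤ B) ∧
          Tendsto lam atTop (𝓝 l) := by
  obtain ⟨B, hB, hev⟩ := exists_eventually_bounded_multiplier (xstar := xstar) hφ hQ hM hreg
  refine ⟨B, hB, fun y hy hlim => ?_⟩
  obtain ⟨k₀, hk₀⟩ := eventually_atTop.1 (hlim.eventually hev)
  choose lam hlam hn using fun k => hk₀ (k + k₀) (by omega) (hy _)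
  obtain ⟨l, -, σ, hσ, hl⟩ := (isCompact_closedBall (0 : EuclideanSpace ℝ (Fin m)) B).tendsto_subseq
    fun k => mem_closedBall_zero_iff.2 (hn k)
  exact ⟨fun j => σ j + k₀, lam ∘ σ, l, hσ.add_const k₀, fun j => hlam _, fun j => hn _, hl⟩

theorem innerSemicompactAt_multiplierMap (hφ : ContDiff ℝ 1 φ) (hQ : IsClosed Q)
    (hM : MetricallySubregularAt (constraintMap φ Q) x 0) (hreg : ClarkeRegularNear Q (φ x)) :
    InnerSemicompactAt (multiplierMap φ Q) (WithLp.toLp 2 (x, xstar))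
      (svDom (multiplierMap φ Q)) := by
  obtain ⟨B, -, h⟩ := exists_convergent_multipliers (xstar := xstar) hφ hQ hM hreg
  intro y hy hlim
  obtain ⟨σ, lam, l, hσ, hlam, -, hl⟩ := h y hy hlim
  exact ⟨σ, lam, l, hσ, hlam, hl⟩

end MultiplierMap

/-! ### Inner calmness* for polyhedral sets -/

section InnerCalmness

variable {n m : ℕ} {φ : EuclideanSpace ℝ (Fin n) → EuclideanSpace ℝ (Fin m)}
  {Q : Set (EuclideanSpace ℝ (Fin m))} {x xstar : EuclideanSpace ℝ (Fin n)}

theorem tendsto_inv_smul_adjoint_fderiv_sub (hφ : ContDiff ℝ 2 φ) {u : EuclideanSpace ℝ (Fin n)}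
    {t : ℕ → ℝ} {w : ℕ → EuclideanSpace ℝ (Fin n)} (ht : ∀ k, 0 < t k)
    (ht0 : Tendsto t atTop (𝓝 0)) (hw : Tendsto w atTop (𝓝 u)) :
    Tendsto (fun k => (t k)⁻¹ • (ContinuousLinearMap.adjoint (fderiv ℝ φ (x + t k • w k)) -
        ContinuousLinearMap.adjoint (fderiv ℝ φ x))) atTop
      (𝓝 (ContinuousLinearMap.adjoint (fderiv ℝ (fderiv ℝ φ) x u))) := by
  have hd : DifferentiableAt ℝ (fderiv ℝ φ) x :=
    (hφ.fderiv_right (m := 1) (by norm_num)).differentiable one_ne_zero x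
  have h := (ContinuousLinearMap.adjoint.continuous.tendsto _).comp
    (hd.hasFDerivAt.tendsto_inv_smul_sub ht ht0 hw)
  refine h.congr fun k => ?_
  simp [map_sub]

theorem exists_eventually_norm_adjoint_fderiv_sub_le (hφ : ContDiff ℝ 2 φ)
    (x : EuclideanSpace ℝ (Fin n)) :
    ∃ L : ℝ, 0 < L ∧ ∀ᶠ p in 𝓝 x, ‖ContinuousLinearMap.adjoint (fderiv ℝ φ p) -
        ContinuousLinearMap.adjoint (fderiv ℝ φ x)‖ ≤ L * ‖p - x‖ := by
  have hd : DifferentiableAt ℝ (fderiv ℝ φ) x :=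
    (hφ.fderiv_right (m := 1) (by norm_num)).differentiable one_ne_zero x
  obtain ⟨L, hL, h⟩ := hd.isBigO_sub.exists_pos
  refine ⟨L, hL, h.bound.mono fun p hp => ?_⟩
  rwa [← map_sub, LinearIsometryEquiv.norm_map]

/-- Limits of multipliers satisfy the limiting multiplier equation. -/
theorem adjoint_fderiv_eq_of_tendsto (hφ : ContDiff ℝ 1 φ)
    {y : ℕ → WithLp 2 (EuclideanSpace ℝ (Fin n) × EuclideanSpace ℝ (Fin n))}
    (hy : Tendsto y atTop (𝓝 (WithLp.toLp 2 (x, xstar))))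
    {lam : ℕ → EuclideanSpace ℝ (Fin m)} {l : EuclideanSpace ℝ (Fin m)}
    (hl : Tendsto lam atTop (𝓝 l)) (hlam : ∀ k, lam k ∈ multiplierMap φ Q (y k)) :
    ContinuousLinearMap.adjoint (fderiv ℝ φ x) l = xstar := by
  have hfst : Tendsto (fun k => (y k).fst) atTop (𝓝 x) :=
    (Continuous.tendsto' (by fun_prop) _ _ rfl : Tendsto (fun p : WithLp 2
      (EuclideanSpace ℝ (Fin n) × EuclideanSpace ℝ (Fin n)) => p.fst)
      (𝓝 (WithLp.toLp 2 (x, xstar))) (𝓝 x)).comp hy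
  have hsnd : Tendsto (fun k => (y k).snd) atTop (𝓝 xstar) :=
    (Continuous.tendsto' (by fun_prop) _ _ rfl : Tendsto (fun p : WithLp 2
      (EuclideanSpace ℝ (Fin n) × EuclideanSpace ℝ (Fin n)) => p.snd)
      (𝓝 (WithLp.toLp 2 (x, xstar))) (𝓝 xstar)).comp hy
  have hD : Tendsto (fun k => ContinuousLinearMap.adjoint (fderiv ℝ φ (y k).fst)) atTop
      (𝓝 (ContinuousLinearMap.adjoint (fderiv ℝ φ x))) :=
    (ContinuousLinearMap.adjoint.continuous.tendsto _).comp
      (((hφ.continuous_fderiv one_ne_zero).tendsto x).comp hfst)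
  have h1 : Tendsto (fun k => ContinuousLinearMap.adjoint (fderiv ℝ φ (y k).fst) (lam k)) atTop
      (𝓝 (ContinuousLinearMap.adjoint (fderiv ℝ φ x) l)) :=
    tendsto_clm_apply hD hl
  exact tendsto_nhds_unique h1 (hsnd.congr fun k => (hlam k).2.symm)

theorem exists_strictMono_comp_eq_const {α : Type*} [Finite α] (f : ℕ → α) :
    ∃ (c : α) (τ : ℕ → ℕ), StrictMono τ ∧ ∀ k, f (τ k) = c := by
  obtain ⟨c, hc⟩ := Finite.exists_infinite_fiber f
  obtain ⟨τ, hτ, h⟩ := extraction_of_frequently_atTop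
    (Nat.frequently_atTop_iff_infinite.2 (Set.infinite_coe_iff.1 hc))
  exact ⟨c, τ, hτ, h⟩

/-- Linearizing the multiplier equation at a limit `l` of multipliers `lam k` in a fixed finitely
generated cone yields a limit equation for the difference quotients `(t k)⁻¹ • (lam k - l)`. It is
solvable in the cone generated by `a i`, `i ∈ I`, and `-l`, since linear images of finitely
generated cones are closed. -/
theorem exists_conic_solution {ι E F : Type*} [NormedAddCommGroup E] [InnerProductSpace ℝ E]
    [NormedAddCommGroup F] [InnerProductSpace ℝ F] (D : F →L[ℝ] E) {a : ι → F} {I : Finset ι}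
    {l : F} {r : E} {t : ℕ → ℝ} (ht : ∀ k, 0 < t k) {lam : ℕ → F}
    (hlam : ∀ k, lam k ∈ generatedCone a I)
    (hr : Tendsto (fun k => D ((t k)⁻¹ • (lam k - l))) atTop (𝓝 r)) :
    ∃ v ∈ generatedCone a I, ∃ s : ℝ, 0 ≤ s ∧ D (v - s • l) = r := by
  let b : Option ι → E := fun o => o.elim (-D l) fun i => D (a i)
  have hmem : ∀ k, D ((t k)⁻¹ • (lam k - l)) ∈ generatedCone b (Finset.insertNone I) := by
    intro k
    obtain ⟨c, hc, hck⟩ := hlam k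
    have hinv := inv_nonneg.2 (ht k).le
    refine ⟨fun o => o.elim (t k)⁻¹ fun i => (t k)⁻¹ * c i, ?_, ?_⟩
    · rintro (_ | i)
      exacts [hinv, mul_nonneg hinv (hc i)]
    · simp only [Finset.sum_insertNone, b, Option.elim_none, Option.elim_some, hck, map_smul,
        map_sub, map_sum, mul_smul, ← Finset.smul_sum]
      module
  obtain ⟨d, hd, hdr⟩ := (isClosed_generatedCone b _).mem_of_tendsto hr (Eventually.of_forall hmem)
  refine ⟨∑ i ∈ I, d (some i) • a i, ⟨fun i => d (some i), fun i => hd _, rfl⟩, d none, hd _, ?_⟩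
  rw [hdr]
  simp only [Finset.sum_insertNone, b, Option.elim_none, Option.elim_some, map_sub, map_sum,
    map_smul]
  module

/-- For convex polyhedral `Q`, every tangent direction `(u, u*)` to `dom Λ` is attained by pairs
`(x k, ∇φ(x k)ᵀ (l + t k • ω))`, where `x k` comes from the given tangent sequence and `l` is a
limit of multipliers along it; `ω` solves the linearized multiplier equation in direction
`(u, u*)`. -/
theorem fuzzyInnerCalmStarAt_multiplierMap (hφ : ContDiff ℝ 2 φ) (hQ : IsClosed Q)
    (hM : MetricallySubregularAt (constraintMap φ Q) x 0) (hpoly : IsConvexPolyhedral Q) :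
    FuzzyInnerCalmStarAt (multiplierMap φ Q) (WithLp.toLp 2 (x, xstar))
      (svDom (multiplierMap φ Q)) := by
  have hφ1 : ContDiff ℝ 1 φ := hφ.of_le (by norm_num)
  intro v hv
  refine or_iff_not_imp_left.2 fun hvT => ?_
  obtain ⟨-, y₀, hy₀, hdir₀⟩ := not_not.1 hvT
  obtain ⟨B, -, hB⟩ := exists_convergent_multipliers (xstar := xstar) hφ1 hQ hM
    (hpoly.convex.clarkeRegularNear _)
  obtain ⟨σ, lam₀, l, hσ, hlam₀, -, hl₀⟩ := hB y₀ hy₀ hdir₀.tendsto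
  obtain ⟨N, a, b, hQab⟩ := hpoly
  obtain ⟨I, τ, hτ, hI⟩ :=
    exists_strictMono_comp_eq_const fun k => activeSet a b (φ (y₀ (σ k)).fst)
  obtain ⟨y, lam, hdir, hlam, hl, hI⟩ : ∃ (y : ℕ → WithLp 2 (EuclideanSpace ℝ (Fin n) ×
      EuclideanSpace ℝ (Fin n))) (lam : ℕ → EuclideanSpace ℝ (Fin m)),
      ConvergesFromDirection y (WithLp.toLp 2 (x, xstar)) v ∧
      (∀ k, lam k ∈ multiplierMap φ Q (y k)) ∧ Tendsto lam atTop (𝓝 l) ∧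
      ∀ k, activeSet a b (φ (y k).fst) = I :=
    ⟨y₀ ∘ σ ∘ τ, lam₀ ∘ τ, hdir₀.comp (hσ.comp hτ), fun k => hlam₀ _, hl₀.comp hτ.tendsto_atTop,
      hI⟩
  have hGl := adjoint_fderiv_eq_of_tendsto hφ1 hdir.tendsto hl hlam
  obtain ⟨t, w, ht, ht0, hw, hyt⟩ := hdir
  -- constant active sets make the normal cones along the sequence one and the same cone
  have hcone : ∀ k, limitingNormalCone Q (φ (y k).fst) = generatedCone a I := by
    intro k
    have hmem : φ (y k).fst ∈ Q := (hlam k).1.1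
    rw [hQab] at hmem ⊢
    rw [limitingNormalCone_polyhedral_eq hmem, hI k]
  have hlamI : ∀ k, lam k ∈ generatedCone a I := fun k => hcone k ▸ (hlam k).1
  have hlI : l ∈ generatedCone a I :=
    (isClosed_generatedCone a I).mem_of_tendsto hl (Eventually.of_forall hlamI)
  have hwf : Tendsto (fun k => (w k).fst) atTop (𝓝 v.fst) :=
    ((WithLp.continuous_fst ..).tendsto v).comp hw
  have hws : Tendsto (fun k => (w k).snd) atTop (𝓝 v.snd) :=
    ((WithLp.continuous_snd ..).tendsto v).comp hw
  have hyf : ∀ k, (y k).fst = x + t k • (w k).fst := fun k => by rw [hyt k]; rfl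
  have hys : ∀ k, (y k).snd = xstar + t k • (w k).snd := fun k => by rw [hyt k]; rfl
  set G := fun p => ContinuousLinearMap.adjoint (fderiv ℝ φ p)
  have hGdiff : Tendsto (fun k => (t k)⁻¹ • (G (y k).fst - G x)) atTop
      (𝓝 (ContinuousLinearMap.adjoint (fderiv ℝ (fderiv ℝ φ) x v.fst))) := by
    simp only [hyf]
    exact tendsto_inv_smul_adjoint_fderiv_sub hφ ht ht0 hwf
  set H := ContinuousLinearMap.adjoint (fderiv ℝ (fderiv ℝ φ) x v.fst)
  have hGlim : Tendsto (fun k => G (y k).fst) atTop (𝓝 (G x)) := by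
    have h := (ht0.smul hGdiff).add_const (G x)
    rw [zero_smul, zero_add] at h
    refine h.congr fun k => ?_
    rw [smul_smul, mul_inv_cancel₀ (ht k).ne', one_smul, sub_add_cancel]
  have hr : Tendsto (fun k => G x ((t k)⁻¹ • (lam k - l))) atTop (𝓝 (v.snd - H l)) := by
    have h1 : Tendsto (fun k => ((t k)⁻¹ • (G (y k).fst - G x)) (lam k)) atTop (𝓝 (H l)) :=
      tendsto_clm_apply hGdiff hl
    refine (hws.sub h1).congr fun k => ?_
    have h2 : G (y k).fst (lam k) = xstar + t k • (w k).snd := (hlam k).2.trans (hys k)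
    have h3 : G x l = xstar := hGl
    rw [smul_apply, sub_apply, h2, map_smul, map_sub, h3]
    have h4 : (w k).snd = (t k)⁻¹ • (t k • (w k).snd) := by
      rw [smul_smul, inv_mul_cancel₀ (ht k).ne', one_smul]
    nth_rw 1 [h4]
    module
  obtain ⟨d, hd, s, hs, hsol⟩ := exists_conic_solution (G x) ht hlamI hr
  -- the new multipliers move linearly from `l` in the direction `d - s • l`
  set ω := d - s • l with hω
  let lam' : ℕ → EuclideanSpace ℝ (Fin m) := fun k => l + t k • ω
  let w' : ℕ → WithLp 2 (EuclideanSpace ℝ (Fin n) × EuclideanSpace ℝ (Fin n)) := fun k =>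
    WithLp.toLp 2 ((w k).fst, ((t k)⁻¹ • (G (y k).fst - G x)) l + G (y k).fst ω)
  have hw' : Tendsto w' atTop (𝓝 v) := by
    have h1 : Tendsto (fun k => ((t k)⁻¹ • (G (y k).fst - G x)) l + G (y k).fst ω) atTop
        (𝓝 (H l + G x ω)) :=
      (tendsto_clm_apply hGdiff tendsto_const_nhds).add
        (tendsto_clm_apply hGlim tendsto_const_nhds)
    rw [hsol, add_sub_cancel] at h1
    exact ((WithLp.prod_continuous_toLp 2 _ _).tendsto (v.fst, v.snd)).comp (hwf.prodMk_nhds h1)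
  have hsnd : ∀ k, xstar + t k • (w' k).snd = G (y k).fst (lam' k) := by
    intro k
    have h3 : G x l = xstar := hGl
    simp only [w', lam', WithLp.toLp_snd, smul_apply, sub_apply, map_add, map_smul, smul_add,
      smul_smul, mul_inv_cancel₀ (ht k).ne', one_smul, h3]
    abel
  have hsmall : ∀ᶠ k in atTop, t k * s ≤ 1 := by
    have h : Tendsto (fun k => t k * s) atTop (𝓝 (0 * s)) := ht0.mul_const s
    rw [zero_mul] at h
    exact h.eventually_le_const one_pos
  have hnorm : ∀ᶠ k in atTop, 1 / 2 ≤ ‖w' k‖ := by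
    refine hw'.norm.eventually_const_le ?_
    rw [mem_sphere_zero_iff_norm.1 hv]; norm_num
  obtain ⟨k₀, hk₀⟩ := eventually_atTop.1 (hsmall.and hnorm)
  have hlam' : ∀ k, k₀ ≤ k → lam' k ∈ multiplierMap φ Q
      (WithLp.toLp 2 (x, xstar) + t k • w' k) := by
    intro k hk
    have hfst : (WithLp.toLp 2 (x, xstar) + t k • w' k).fst = (y k).fst := (hyf k).symm
    refine ⟨?_, ?_⟩
    · rw [hfst, hcone k]
      have : lam' k = (1 - t k * s) • l + t k • d := by
        simp only [lam', hω]; module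
      rw [this]
      exact smul_add_smul_mem_generatedCone hlI hd (sub_nonneg.2 (hk₀ k hk).1) (ht k).le
    · rw [hfst]; exact (hsnd k).symm
  refine ⟨2 * ‖ω‖ + 1, by positivity,
    fun k => WithLp.toLp 2 (x, xstar) + t (k + k₀) • w' (k + k₀), fun k => lam' (k + k₀), l,
    fun k => ⟨_, hlam' _ (by omega)⟩, ?_, fun k => ⟨hlam' _ (by omega), ?_⟩⟩
  · exact ⟨fun k => t (k + k₀), fun k => w' (k + k₀), fun k => ht _,
      ht0.comp (tendsto_add_atTop_nat k₀), hw'.comp (tendsto_add_atTop_nat k₀), fun k => rfl⟩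
  · have h1 := (hk₀ (k + k₀) (by omega)).2
    have h2 := ht (k + k₀)
    simp only [lam', add_sub_cancel_left, norm_smul, Real.norm_of_nonneg h2.le]
    have h3 := mul_le_mul_of_nonneg_left h1 (by positivity : 0 ≤ (2 * ‖ω‖ + 1) * t (k + k₀))
    nlinarith [norm_nonneg ω]

/-- Here the given multipliers `lam j` themselves work: they lie, together with their limit `l`, in
the span of the directional normal cone, where `∇φ(x)ᵀ` is bounded below. -/
theorem innerCalmStarInDirection_multiplierMap (hφ : ContDiff ℝ 2 φ) (hQ : IsClosed Q)
    (hM : MetricallySubregularAt (constraintMap φ Q) x 0) (hpoly : IsConvexPolyhedral Q)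
    {u ustar : EuclideanSpace ℝ (Fin n)} (hnd : NondegenerateInDirection φ Q x u) :
    InnerCalmStarInDirection (multiplierMap φ Q) (WithLp.toLp 2 (x, xstar))
      (WithLp.toLp 2 (u, ustar)) (svDom (multiplierMap φ Q)) := by
  have hφ1 : ContDiff ℝ 1 φ := hφ.of_le (by norm_num)
  have hxQ : φ x ∈ Q := by
    obtain ⟨⟨q, hq, h⟩, -⟩ := hM
    rw [sub_eq_zero.1 h.symm]; exact hq
  obtain ⟨B, hB0, hB⟩ := exists_convergent_multipliers (xstar := xstar) hφ1 hQ hM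
    (hpoly.convex.clarkeRegularNear _)
  obtain ⟨L, hL, hLip⟩ := exists_eventually_norm_adjoint_fderiv_sub_le hφ x
  set S := Submodule.span ℝ (limitingNormalCone (bouligandCone Q (φ x)) (fderiv ℝ φ x u))
  set G := fun p => ContinuousLinearMap.adjoint (fderiv ℝ φ p)
  -- by non-degeneracy, `G x` is injective, hence bounded below, on `S`
  obtain ⟨c, hc, hcS⟩ : ∃ c : ℝ, 0 < c ∧ ∀ z ∈ S, ‖z‖ ≤ c * ‖G x z‖ := by
    obtain ⟨K, hK, hanti⟩ :=
      LinearMap.exists_antilipschitzWith ((G x).toLinearMap.domRestrict S) (by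
        refine (LinearMap.ker_eq_bot').2 fun z hz => Subtype.ext ?_
        exact hnd z hz z.2)
    refine ⟨K, hK, fun z hz => ?_⟩
    simpa using hanti.le_mul_dist (⟨z, hz⟩ : S) 0
  refine ⟨c * (1 + L * B), by positivity, fun y hy hdir => ?_⟩
  obtain ⟨σ, lam, l, hσ, hlam, hlamB, hl⟩ := hB y hy hdir.tendsto
  have hdirσ := hdir.comp hσ
  have hGl : G x l = xstar := adjoint_fderiv_eq_of_tendsto hφ1 hdirσ.tendsto hl hlam
  have hfst : ConvergesFromDirection (fun j => (y (σ j)).fst) x u := by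
    obtain ⟨t, w, ht, ht0, hw, hyt⟩ := hdirσ
    exact ⟨t, fun k => (w k).fst, ht, ht0, ((WithLp.continuous_fst ..).tendsto _).comp hw,
      fun k => congrArg WithLp.fst (hyt k)⟩
  have hlamS : ∀ᶠ j in atTop, lam j ∈ S := by
    have hmap := hfst.map (hφ1.differentiable one_ne_zero x).hasFDerivAt
    have hmemQ : ∀ j, φ (y (σ j)).fst ∈ Q := fun j => (hlam j).1.1
    obtain ⟨N, a, b, rfl⟩ := hpoly
    filter_upwards [eventually_limitingNormalCone_subset hxQ hmemQ hmap] with j hj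
    exact Submodule.subset_span (hj (hlam j).1)
  have hlS : l ∈ S := S.closed_of_finiteDimensional.mem_of_tendsto hl hlamS
  obtain ⟨j₀, hj₀⟩ := eventually_atTop.1 (hlamS.and (hfst.tendsto.eventually hLip))
  refine ⟨fun j => σ (j + j₀), fun j => lam (j + j₀), l, hσ.comp (strictMono_id.add_const j₀),
    fun j => ⟨hlam _, ?_⟩⟩
  obtain ⟨hjS, hjL⟩ := hj₀ (j + j₀) (by omega)
  have hj := hlam (j + j₀)
  have hjB := hlamB (j + j₀)
  beta_reduce
  generalize lam (j + j₀) = mu at *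
  generalize y (σ (j + j₀)) = p at *
  have hp1 : ‖p.fst - x‖ ≤ ‖p - WithLp.toLp 2 (x, xstar)‖ :=
    WithLp.norm_fst_le (x := p - WithLp.toLp 2 (x, xstar)) ..
  have hp2 : ‖p.snd - xstar‖ ≤ ‖p - WithLp.toLp 2 (x, xstar)‖ :=
    WithLp.norm_snd_le (x := p - WithLp.toLp 2 (x, xstar)) ..
  have hsplit : G x (mu - l) = (p.snd - xstar) - (G p.fst - G x) mu := by
    have : G p.fst mu = p.snd := hj.2
    rw [sub_apply, map_sub, hGl, this]
    abel
  have hop : ‖(G p.fst - G x) mu‖ ≤ L * B * ‖p - WithLp.toLp 2 (x, xstar)‖ :=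
    calc ‖(G p.fst - G x) mu‖ ≤ ‖G p.fst - G x‖ * ‖mu‖ := ContinuousLinearMap.le_opNorm _ _
      _ ≤ (L * ‖p - WithLp.toLp 2 (x, xstar)‖) * B := by
          gcongr
          exact hjL.trans (by gcongr)
      _ = L * B * ‖p - WithLp.toLp 2 (x, xstar)‖ := by ring
  calc ‖mu - l‖ ≤ c * ‖G x (mu - l)‖ := hcS _ (S.sub_mem hjS hlS)
    _ ≤ c * (‖p.snd - xstar‖ + ‖(G p.fst - G x) mu‖) := by
        rw [hsplit]; gcongr; exact norm_sub_le _ _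
    _ ≤ c * (‖p - WithLp.toLp 2 (x, xstar)‖ + L * B * ‖p - WithLp.toLp 2 (x, xstar)‖) := by
        gcongr
    _ = c * (1 + L * B) * ‖p - WithLp.toLp 2 (x, xstar)‖ := by ring

end InnerCalmness

theorem theorem3p5 {n m : ℕ}
    (φ : EuclideanSpace ℝ (Fin n) → EuclideanSpace ℝ (Fin m)) (hφ : ContDiff ℝ 2 φ)
    (Q : Set (EuclideanSpace ℝ (Fin m))) (hQ : IsClosed Q)
    (x xstar : EuclideanSpace ℝ (Fin n))
    (hx : xstar ∈ limitingNormalCone (φ ⁻¹' Q) x)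
    (hM : MetricallySubregularAt (constraintMap φ Q) x 0) :
    (ClarkeRegularNear Q (φ x) →
      InnerSemicompactAt (multiplierMap φ Q) (WithLp.toLp 2 (x, xstar))
        (svDom (multiplierMap φ Q))) ∧
    (Convex ℝ Q → ClarkeRegularNear Q (φ x)) ∧
    (IsConvexPolyhedral Q →
      FuzzyInnerCalmStarAt (multiplierMap φ Q) (WithLp.toLp 2 (x, xstar))
        (svDom (multiplierMap φ Q))) ∧
    (∀ u ustar : EuclideanSpace ℝ (Fin n),
      WithLp.toLp 2 (u, ustar) ∈
        Metric.sphere (0 : WithLp 2 (EuclideanSpace ℝ (Fin n) × EuclideanSpace ℝ (Fin n))) 1 →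
      IsConvexPolyhedral Q →
      NondegenerateInDirection φ Q x u →
      InnerCalmStarInDirection (multiplierMap φ Q) (WithLp.toLp 2 (x, xstar))
        (WithLp.toLp 2 (u, ustar)) (svDom (multiplierMap φ Q))) :=

  ⟨innerSemicompactAt_multiplierMap (hφ.of_le (by norm_num)) hQ hM,
    fun hconv => hconv.clarkeRegularNear _,
    fuzzyInnerCalmStarAt_multiplierMap hφ hQ hM,
    fun _ _ _ hpoly hnd => innerCalmStarInDirection_multiplierMap hφ hQ hM hpoly hnd⟩
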